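/- For a lattice $L\subseteq\mathbb R^n$ and $\alpha>0$ put $\mathcal E(f_\alpha,L)=\sum_{x\in L\setminus\{0\}}e^{-\alpha\|x\|^2}$, regarded as a function on the manifold of $n$-dimensional lattices of point density $1$; the lattices in this manifold near $L$ are the lattices $AL$ with $\det A=1$ and $A$ near $I_n$. Call $L$ critical for $f_\alpha$ if the differential of this function vanishes at $L$, and a saddle point if it is critical but neither a local minimum nor a local maximum. Let $L(2)=\{x\in L: x\cdot x=2\}$ be the set of roots of $L$, and let $Q[H]=\sum_{x\in L(2)}(x^{\mathsf T}Hx)^2$, a quadratic form on the space of real symmetric $n\times n$ matrices $H$; its eigenvalues are taken with respect to the inner product $\langle A,B\rangle=\operatorname{Tr}(AB)$. Let $L$ be an even unimodular lattice in dimension $n\le 32$ with $L(2)\neq\emptyset$. Then there is an $\alpha_0>0$, depending only on $L$, such that for every $\alpha\ge\alpha_0$ for which $L$ is critical for $f_\alpha$: (i) $L$ is a local minimum of $\mathcal E(f_\alpha,\cdot)$ if and only if all eigenvalues of $Q$ are strictly positive; (ii) if $0$ is an eigenvalue of $Q$, then $L$ is a saddle point of $\mathcal E(f_\alpha,\cdot)$.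 -/

import Mathlib

open Filter

noncomputable section

namespace GaussianCore

/-- The value `H[x] = xᵀ H x` of the quadratic form with matrix `H`. -/
def quad {n : ℕ} (H : Matrix (Fin n) (Fin n) ℝ) (x : EuclideanSpace ℝ (Fin n)) : ℝ :=
  x.ofLp ⬝ᵥ (H.mulVec x.ofLp)

/-- `L` coincides with its dual lattice `{y | x ⬝ y ∈ ℤ for all x ∈ L}`. -/
def IsUnimodular {n : ℕ} (L : Submodule ℤ (EuclideanSpace ℝ (Fin n))) : Prop :=
  (L : Set (EuclideanSpace ℝ (Fin n))) = {y | ∀ x ∈ L, ∃ k : ℤ, inner ℝ x y = (k : ℝ)}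

/-- Every vector of `L` has an even integer as its squared length. -/
def IsEven {n : ℕ} (L : Submodule ℤ (EuclideanSpace ℝ (Fin n))) : Prop :=
  ∀ x ∈ L, ∃ k : ℤ, inner ℝ x x = 2 * (k : ℝ)

/-- The vectors of `L` of squared length `s`; `shell L 2` is the set of roots of `L`. -/
def shell {n : ℕ} (L : Submodule ℤ (EuclideanSpace ℝ (Fin n))) (s : ℝ) :
    Set (EuclideanSpace ℝ (Fin n)) :=
  {x | x ∈ L ∧ inner ℝ x x = s}

/-- The Gaussian potential function `f_α(r) = e^{-α r}`. -/
def gaussian (α : ℝ) (r : ℝ) : ℝ := Real.exp (-α * r)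

/-- The `f`-potential energy of `L`: the sum of `f(‖x‖²)` over all nonzero `x ∈ L`. -/
def energy {n : ℕ} (f : ℝ → ℝ) (L : Submodule ℤ (EuclideanSpace ℝ (Fin n))) : ℝ :=
  ∑' x : {x : EuclideanSpace ℝ (Fin n) // x ∈ L ∧ x ≠ 0}, f (‖x.1‖ ^ 2)

/-- The image `A L` of `L` under a matrix `A`. -/
def transform {n : ℕ} (A : Matrix (Fin n) (Fin n) ℝ)
    (L : Submodule ℤ (EuclideanSpace ℝ (Fin n))) : Submodule ℤ (EuclideanSpace ℝ (Fin n)) :=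
  L.map ((Matrix.toEuclideanLin A).restrictScalars ℤ)

/-- `L` is a local minimum of `f`-potential energy among the lattices of the same point density.
The lattices of this density near `L` are the lattices `A L` with `det A = 1` and `A` near the
identity matrix. -/
def IsLocalMinimum {n : ℕ} (f : ℝ → ℝ) (L : Submodule ℤ (EuclideanSpace ℝ (Fin n))) : Prop :=
  IsLocalMinOn (fun A : Matrix (Fin n) (Fin n) ℝ => energy f (transform A L)) {A | A.det = 1} 1

/-- `L` is a local maximum of `f`-potential energy among the lattices of the same point density. -/
def IsLocalMaximum {n : ℕ} (f : ℝ → ℝ) (L : Submodule ℤ (EuclideanSpace ℝ (Fin n))) : Prop :=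
  IsLocalMaxOn (fun A : Matrix (Fin n) (Fin n) ℝ => energy f (transform A L)) {A | A.det = 1} 1

/-- `L` is a critical point of `f`-potential energy on the manifold of lattices of the same point
density: the derivative of the energy vanishes in the direction of every tangent vector. The
tangent vectors of `{A | det A = 1}` at the identity are the traceless matrices `H`, and
`t ↦ exp(tH)` is a curve through the identity with velocity `H`. -/
def IsCritical {n : ℕ} (f : ℝ → ℝ) (L : Submodule ℤ (EuclideanSpace ℝ (Fin n))) : Prop :=
  ∀ H : Matrix (Fin n) (Fin n) ℝ, H.trace = 0 →
    HasDerivAt (fun t : ℝ => energy f (transform (NormedSpace.exp (t • H)) L)) 0 0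

/-- A saddle point: a critical point that is neither a local minimum nor a local maximum. -/
def IsSaddlePoint {n : ℕ} (f : ℝ → ℝ) (L : Submodule ℤ (EuclideanSpace ℝ (Fin n))) : Prop :=
  IsCritical f L ∧ ¬ IsLocalMinimum f L ∧ ¬ IsLocalMaximum f L

/-- The bilinear form `b_Q(G, H) = ∑ G[x] H[x]`, the sum being over the roots `x` of `L`; the
associated quadratic form is `Q[H] = ∑ H[x]²`. -/
def bQ {n : ℕ} (L : Submodule ℤ (EuclideanSpace ℝ (Fin n))) (G H : Matrix (Fin n) (Fin n) ℝ) : ℝ :=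
  ∑ᶠ x ∈ shell L 2, quad G x * quad H x

/-- `μ` is an eigenvalue of the quadratic form `Q` on the space of symmetric matrices with the
inner product `⟨A, B⟩ = Tr(AB)`, i.e. an eigenvalue of the operator `T` with
`b_Q(G, H) = ⟨G, T H⟩`, equivalently of the Gram matrix of `b_Q` in an orthonormal basis. -/
def IsEigenvalueQ {n : ℕ} (L : Submodule ℤ (EuclideanSpace ℝ (Fin n))) (μ : ℝ) : Prop :=
  ∃ H : Matrix (Fin n) (Fin n) ℝ, H.IsSymm ∧ H ≠ 0 ∧
    ∀ G : Matrix (Fin n) (Fin n) ℝ, G.IsSymm → bQ L G H = μ * (G * H).trace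

end GaussianCore

end

/-! Write `S = AᵀA - 1`, so that `‖Ax‖² = ‖x‖² + S[x]`. Splitting off the part of each summand that
is linear in `S` gives E(AL) - E(L) = -α M(S) + R(S), where M(S) = ∑ e^{-α‖x‖²} S[x]
(`gaussianMoment`) and R(S) is a sum of nonnegative convexity remainders, about (α²/2) ∑ e^{-α‖x‖²}
S[x]² (`hasSum_energy_sub`). At a critical lattice M vanishes on traceless symmetric matrices, so
M(S) = (tr S / n) M(1) (`gaussianMoment_of_isCritical`). When det A = 1, tr S is of second order, so
-α M(S) is a second-order term of size α e^{-2α}, because M(1) is comparable to e^{-2α} when roots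
exist.

The outcome depends on R. Each root x contributes about α² e^{-2α} S[x]², which wins by a factor α
wherever S does not vanish on the roots. Evenness puts all other vectors at squared norm at least 4,
so for H in the kernel of Q the quadratic part of R is exponentially smaller than e^{-2α}, and the
negative term wins. Hence a trivial kernel gives a minimum, and a nonzero traceless H in the kernel
gives a descent direction, with an ascent direction built from any root. If some H in the kernel has
nonzero trace, M(H) = (tr H / n) M(1) would have both order e^{-4α} and order e^{-2α}, so L is not
critical for large α. -/

namespace GaussianCore

open scoped Matrix.Norms.L2Operator Topology
open Matrix

/-! ### Quadratic forms, traces under det = 1, and the curve exp(tH) -/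

section Quad

variable {n : ℕ}

lemma quad_add (G H : Matrix (Fin n) (Fin n) ℝ) (x : EuclideanSpace ℝ (Fin n)) :
    quad (G + H) x = quad G x + quad H x := by
  simp [quad, Matrix.add_mulVec]

lemma quad_sub (G H : Matrix (Fin n) (Fin n) ℝ) (x : EuclideanSpace ℝ (Fin n)) :
    quad (G - H) x = quad G x - quad H x := by
  simp [quad, Matrix.sub_mulVec]

lemma quad_smul (c : ℝ) (H : Matrix (Fin n) (Fin n) ℝ) (x : EuclideanSpace ℝ (Fin n)) :
    quad (c • H) x = c * quad H x := by
  simp [quad, Matrix.smul_mulVec]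

lemma quad_one (x : EuclideanSpace ℝ (Fin n)) : quad 1 x = ‖x‖ ^ 2 := by
  rw [quad, Matrix.one_mulVec, EuclideanSpace.real_norm_sq_eq, dotProduct]
  simp [sq]

lemma quad_vecMulVec (x y : EuclideanSpace ℝ (Fin n)) :
    quad (Matrix.vecMulVec x.ofLp x.ofLp) y = (x.ofLp ⬝ᵥ y.ofLp) ^ 2 := by
  rw [quad, Matrix.vecMulVec_mulVec, dotProduct_smul]
  simp [sq, dotProduct_comm]

lemma norm_sq_toEuclideanLin (A : Matrix (Fin n) (Fin n) ℝ) (x : EuclideanSpace ℝ (Fin n)) :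
    ‖Matrix.toEuclideanLin A x‖ ^ 2 = quad (Aᵀ * A) x := by
  rw [← quad_one, quad, quad, Matrix.one_mulVec, ← Matrix.mulVec_mulVec, Matrix.mulVec_transpose,
    dotProduct_comm x.ofLp, ← Matrix.dotProduct_mulVec]
  rfl

lemma abs_quad_le (S : Matrix (Fin n) (Fin n) ℝ) (x : EuclideanSpace ℝ (Fin n)) :
    |quad S x| ≤ ‖S‖ * ‖x‖ ^ 2 := by
  have h : quad S x = inner ℝ x (Matrix.toEuclideanCLM (n := Fin n) (𝕜 := ℝ) S x) := by
    rw [EuclideanSpace.inner_eq_star_dotProduct, dotProduct_comm]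
    rfl
  rw [h]
  calc _ ≤ ‖x‖ * ‖Matrix.toEuclideanCLM (n := Fin n) (𝕜 := ℝ) S x‖ := abs_real_inner_le_norm _ _
    _ ≤ ‖x‖ * (‖S‖ * ‖x‖) := by
        gcongr
        exact ContinuousLinearMap.le_opNorm _ _
    _ = _ := by ring

lemma quad_single (S : Matrix (Fin n) (Fin n) ℝ) (i : Fin n) :
    quad S (EuclideanSpace.single i 1) = S i i := by
  simp [quad]

lemma abs_trace_le (S : Matrix (Fin n) (Fin n) ℝ) : |S.trace| ≤ n * ‖S‖ := by
  have h : ∀ i, |S i i| ≤ ‖S‖ := fun i ↦ by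
    have := abs_quad_le S (EuclideanSpace.single i 1)
    rw [quad_single] at this
    simpa using this
  calc |S.trace| ≤ ∑ i, |S i i| := Finset.abs_sum_le_sum_abs _ _
    _ ≤ ∑ _i : Fin n, ‖S‖ := Finset.sum_le_sum fun i _ ↦ h i
    _ = _ := by simp

lemma trace_mul_self_pos {H : Matrix (Fin n) (Fin n) ℝ} (hs : H.IsSymm) (h0 : H ≠ 0) :
    0 < (H * H).trace := by
  have h1 : (H * H).trace = ∑ i, ∑ j, H i j ^ 2 := by
    simp only [Matrix.trace, Matrix.diag, Matrix.mul_apply]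
    refine Finset.sum_congr rfl fun i _ ↦ Finset.sum_congr rfl fun j _ ↦ ?_
    rw [hs.apply i j, sq]
  obtain ⟨i, j, hij⟩ : ∃ i j, H i j ≠ 0 := by
    by_contra! h
    exact h0 (by ext i j; simpa using h i j)
  rw [h1]
  refine Finset.sum_pos' (fun i _ ↦ Finset.sum_nonneg fun j _ ↦ sq_nonneg _) ⟨i, Finset.mem_univ _, ?_⟩
  exact Finset.sum_pos' (fun j _ ↦ sq_nonneg _) ⟨j, Finset.mem_univ _, by positivity⟩

lemma det_exp_of_isSymm {H : Matrix (Fin n) (Fin n) ℝ} (hs : H.IsSymm) :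
    (NormedSpace.exp H).det = Real.exp H.trace := by
  have hH : H.IsHermitian := by
    rw [Matrix.IsHermitian, Matrix.conjTranspose_eq_transpose_of_trivial]; exact hs
  have hU : IsUnit (hH.eigenvectorUnitary : Matrix (Fin n) (Fin n) ℝ) :=
    (Unitary.toUnits hH.eigenvectorUnitary).isUnit
  have hinv : (hH.eigenvectorUnitary : Matrix (Fin n) (Fin n) ℝ)⁻¹ =
      star (hH.eigenvectorUnitary : Matrix (Fin n) (Fin n) ℝ) :=
    Matrix.inv_eq_left_inv (Unitary.coe_star_mul_self _)
  have hspec : H = (hH.eigenvectorUnitary : Matrix (Fin n) (Fin n) ℝ) *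
      Matrix.diagonal hH.eigenvalues * (hH.eigenvectorUnitary : Matrix (Fin n) (Fin n) ℝ)⁻¹ := by
    rw [hinv]
    exact hH.spectral_theorem
  have htr : H.trace = ∑ i, hH.eigenvalues i := by simpa using hH.trace_eq_sum_eigenvalues
  rw [htr]
  conv_lhs => rw [hspec]
  rw [Matrix.exp_conj _ _ hU, Matrix.det_conj hU, Matrix.exp_diagonal, Matrix.det_diagonal,
    Real.exp_sum]
  refine Finset.prod_congr rfl fun i _ ↦ ?_
  rw [Pi.coe_exp, Real.exp_eq_exp_ℝ]

/-- A converse to AM-GM near the identity: the logarithms of the eigenvalues λ sum to 0, and λ - 1 -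
log λ ≤ (λ - 1)²/λ ≤ 2(λ - 1)² once λ ≥ 1/2. This makes the linear term of the energy second order
on det = 1. -/
lemma trace_sub_one_le {P : Matrix (Fin n) (Fin n) ℝ} (hs : P.IsSymm) (hdet : P.det = 1)
    (hP : ‖P - 1‖ ≤ 1 / 2) : (P - 1).trace ≤ n * (2 * ‖P - 1‖ ^ 2) := by
  have hH : P.IsHermitian := by
    rw [Matrix.IsHermitian, Matrix.conjTranspose_eq_transpose_of_trivial]; exact hs
  have hev : ∀ i, |hH.eigenvalues i - 1| ≤ ‖P - 1‖ := fun i ↦ by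
    have h1 := abs_quad_le (P - 1) (hH.eigenvectorBasis i)
    have h2 : quad P (hH.eigenvectorBasis i) = hH.eigenvalues i := by
      rw [quad, hH.mulVec_eigenvectorBasis, dotProduct_smul]
      have := quad_one (hH.eigenvectorBasis i)
      rw [quad, Matrix.one_mulVec] at this
      rw [this]; simp
    rw [quad_sub, quad_one, h2] at h1
    simpa using h1
  have htr : (P - 1).trace = ∑ i, (hH.eigenvalues i - 1) := by
    rw [Matrix.trace_sub, hH.trace_eq_sum_eigenvalues]
    simp
  have hlog : ∑ i, Real.log (hH.eigenvalues i) = 0 := by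
    have h := hH.det_eq_prod_eigenvalues
    rw [hdet] at h
    rw [← Real.log_prod]
    · have : ∏ i, hH.eigenvalues i = 1 := by simpa using h.symm
      rw [this, Real.log_one]
    · intro i _
      have := abs_le.1 ((hev i).trans hP)
      linarith
  have hle : ∀ i, hH.eigenvalues i - 1 ≤ Real.log (hH.eigenvalues i) + 2 * ‖P - 1‖ ^ 2 := by
    intro i
    have h1 := abs_le.1 ((hev i).trans hP)
    have hpos : 0 < hH.eigenvalues i := by linarith
    have h2 := Real.one_sub_inv_le_log_of_pos hpos
    have h3 : (hH.eigenvalues i - 1) ^ 2 ≤ ‖P - 1‖ ^ 2 := sq_le_sq' (by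
      linarith [abs_le.1 (hev i)]) (abs_le.1 (hev i)).2
    have h4 : (hH.eigenvalues i)⁻¹ ≤ 2 := by
      rw [inv_le_comm₀ hpos (by norm_num)]; linarith
    have h5 : hH.eigenvalues i - 1 - (1 - (hH.eigenvalues i)⁻¹) =
        (hH.eigenvalues i)⁻¹ * (hH.eigenvalues i - 1) ^ 2 := by
      field_simp
    have h6 := mul_le_mul h4 h3 (sq_nonneg _) (by norm_num)
    linarith
  calc (P - 1).trace ≤ ∑ i, (Real.log (hH.eigenvalues i) + 2 * ‖P - 1‖ ^ 2) := by
        rw [htr]; exact Finset.sum_le_sum fun i _ ↦ hle i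
    _ = _ := by
        rw [Finset.sum_add_distrib, hlog]
        simp

/-- Second-order Taylor estimate for the matrix exponential along a line. -/
lemma exp_smul_sub_isBigO (H : Matrix (Fin n) (Fin n) ℝ) :
    (fun t : ℝ ↦ NormedSpace.exp (t • H) - 1 - t • H) =O[𝓝 0] fun t ↦ t ^ 2 := by
  have h := (NormedSpace.exp_hasFPowerSeriesAt_zero (𝕂 := ℝ)
    (𝔸 := Matrix (Fin n) (Fin n) ℝ)).isBigO_sub_partialSum_pow 2
  have ht : Tendsto (fun t : ℝ ↦ t • H) (𝓝 0) (𝓝 0) := by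
    have : Continuous fun t : ℝ ↦ t • H := by fun_prop
    simpa using this.tendsto 0
  have h2 := h.comp_tendsto ht
  refine (h2.congr_left fun t ↦ ?_).trans ?_
  · simp [FormalMultilinearSeries.partialSum, Finset.sum_range_succ,
      NormedSpace.expSeries_apply_eq, sub_sub]
  · refine Asymptotics.IsBigO.of_bound (‖H‖ ^ 2) (Eventually.of_forall fun t ↦ ?_)
    simp [norm_smul, mul_pow, mul_comm]

/-- Third-order Taylor estimate for the matrix exponential along a line. -/
lemma exp_smul_sub_isBigO_cube (H : Matrix (Fin n) (Fin n) ℝ) :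
    (fun t : ℝ ↦ NormedSpace.exp (t • H) - 1 - t • H - (t ^ 2 / 2) • (H * H))
      =O[𝓝 0] fun t ↦ t ^ 3 := by
  have h := (NormedSpace.exp_hasFPowerSeriesAt_zero (𝕂 := ℝ)
    (𝔸 := Matrix (Fin n) (Fin n) ℝ)).isBigO_sub_partialSum_pow 3
  have ht : Tendsto (fun t : ℝ ↦ t • H) (𝓝 0) (𝓝 0) := by
    have : Continuous fun t : ℝ ↦ t • H := by fun_prop
    simpa using this.tendsto 0
  have h2 := h.comp_tendsto ht
  refine (h2.congr_left fun t ↦ ?_).trans ?_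
  · simp [FormalMultilinearSeries.partialSum, Finset.sum_range_succ,
      NormedSpace.expSeries_apply_eq, sub_sub, smul_smul, sq, Nat.factorial]
    ring_nf
  · refine Asymptotics.IsBigO.of_bound (‖H‖ ^ 3) (Eventually.of_forall fun t ↦ ?_)
    simp [norm_smul, mul_pow, mul_comm]

lemma transpose_exp_mul_exp {H : Matrix (Fin n) (Fin n) ℝ} (hs : H.IsSymm) (t : ℝ) :
    (NormedSpace.exp (t • H))ᵀ * NormedSpace.exp (t • H) = NormedSpace.exp ((2 * t) • H) := by
  rw [← Matrix.exp_transpose, Matrix.transpose_smul, hs.eq,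
    ← Matrix.exp_add_of_commute _ _ (Commute.refl _), ← add_smul, two_mul]

lemma isSymm_transpose_mul_sub_one (A : Matrix (Fin n) (Fin n) ℝ) : (Aᵀ * A - 1).IsSymm := by
  simp [Matrix.IsSymm]

/-- The deviation of the Gram matrix along `t ↦ exp (t H)` is `2 t H` up to second order. -/
lemma exists_gram_exp_bound {H : Matrix (Fin n) (Fin n) ℝ} (hs : H.IsSymm) :
    ∃ C > 0, ∀ᶠ t : ℝ in 𝓝 0,
      ‖(NormedSpace.exp (t • H))ᵀ * NormedSpace.exp (t • H) - 1 - (2 * t) • H‖ ≤ C * t ^ 2 ∧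
      ‖(NormedSpace.exp (t • H))ᵀ * NormedSpace.exp (t • H) - 1‖ ≤ C * |t| := by
  have ht : Tendsto (fun t : ℝ ↦ 2 * t) (𝓝 0) (𝓝 0) := by
    have : Continuous fun t : ℝ ↦ 2 * t := by fun_prop
    simpa using this.tendsto 0
  obtain ⟨C, hC, h⟩ := ((exp_smul_sub_isBigO H).comp_tendsto ht).exists_pos
  refine ⟨4 * C + 2 * ‖H‖, by positivity, ?_⟩
  have h1 : ∀ᶠ t : ℝ in 𝓝 0, |t| < 1 := by
    have := Metric.ball_mem_nhds (0 : ℝ) one_pos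
    filter_upwards [this] with t ht
    simpa using ht
  filter_upwards [h.bound, h1] with t h2 h3
  rw [transpose_exp_mul_exp hs]
  simp only [Function.comp_apply, norm_pow, norm_mul, Real.norm_ofNat, Real.norm_eq_abs, mul_pow,
    sq_abs] at h2
  have h4 : ‖(2 * t) • H‖ = 2 * ‖H‖ * |t| := by
    rw [norm_smul, Real.norm_eq_abs, abs_mul, abs_two]; ring
  have h5 : t ^ 2 ≤ |t| := by
    rw [← sq_abs]; nlinarith [abs_nonneg t]
  refine ⟨?_, ?_⟩
  · nlinarith [sq_nonneg t, norm_nonneg H, mul_nonneg (norm_nonneg H) (sq_nonneg t)]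
  · calc _ ≤ ‖NormedSpace.exp ((2 * t) • H) - 1 - (2 * t) • H‖ + ‖(2 * t) • H‖ :=
          norm_le_norm_sub_add _ _
      _ ≤ C * (2 ^ 2 * |t|) + 2 * ‖H‖ * |t| := by
          rw [h4]
          gcongr
          exact h2.trans (by gcongr)
      _ = _ := by ring

/-- Along `t ↦ exp (t H)` with `H` symmetric and traceless, the trace of the Gram matrix grows
at least quadratically. -/
lemma eventually_le_trace_gram_exp {H : Matrix (Fin n) (Fin n) ℝ} (hs : H.IsSymm)
    (h0 : H ≠ 0) (htr : H.trace = 0) :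
    ∀ᶠ t : ℝ in 𝓝 0, (H * H).trace * t ^ 2 ≤
      ((NormedSpace.exp (t • H))ᵀ * NormedSpace.exp (t • H) - 1).trace := by
  have ht : Tendsto (fun t : ℝ ↦ 2 * t) (𝓝 0) (𝓝 0) := by
    have : Continuous fun t : ℝ ↦ 2 * t := by fun_prop
    simpa using this.tendsto 0
  obtain ⟨C, hC, h⟩ := ((exp_smul_sub_isBigO_cube H).comp_tendsto ht).exists_pos
  have hpos := trace_mul_self_pos hs h0
  -- The trace is 2 tr(H²) t² + O(t³); for such t the cubic error uses up at most half of the main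
  -- term.
  have h1 : ∀ᶠ t : ℝ in 𝓝 0, n * C * 8 * |t| < (H * H).trace := by
    have hc : Continuous fun t : ℝ ↦ n * C * 8 * |t| := by fun_prop
    exact (hc.tendsto 0).eventually_lt_const (by simpa using hpos)
  filter_upwards [h.bound, h1] with t h2 h3
  rw [transpose_exp_mul_exp hs]
  simp only [Function.comp_apply, norm_pow, norm_mul, Real.norm_ofNat, Real.norm_eq_abs, mul_pow]
    at h2
  have h4 := abs_trace_le
    (NormedSpace.exp ((2 * t) • H) - 1 - (2 * t) • H - (2 ^ 2 * t ^ 2 / 2) • (H * H))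
  rw [Matrix.trace_sub, Matrix.trace_sub _ ((2 * t) • H), Matrix.trace_smul, Matrix.trace_smul,
    htr] at h4
  have h5 := (abs_le.1 h4).1
  have h6 : (n : ℝ) * ‖NormedSpace.exp ((2 * t) • H) - 1 - (2 * t) • H -
      (2 ^ 2 * t ^ 2 / 2) • (H * H)‖ ≤ (H * H).trace * t ^ 2 := by
    calc _ ≤ (n : ℝ) * (C * (2 ^ 3 * |t| ^ 3)) := by gcongr
      _ = (n * C * 8 * |t|) * t ^ 2 := by rw [← sq_abs t]; ring
      _ ≤ _ := by gcongr
  simp only [smul_eq_mul] at h5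
  nlinarith

end Quad

/-! ### Lattice sums and the convexity expansion of the energy -/

section Energy

variable {n : ℕ}

lemma exists_pow_mul_exp_le (m : ℕ) {a : ℝ} (ha : 0 < a) :
    ∃ K : ℝ, ∀ r : ℝ, 0 ≤ r → r ^ m * Real.exp (-a * r ^ 2) ≤ K := by
  refine ⟨1 + m.factorial / a ^ m, fun r hr ↦ ?_⟩
  -- Passing to a power of `r ^ 2` lets a single term of the exponential series of `a * r ^ 2` give
  -- the bound.
  have h1 : r ^ m ≤ 1 + (r ^ 2) ^ m := by
    rw [← pow_mul, mul_comm 2 m, pow_mul]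
    nlinarith [sq_nonneg (r ^ m - 1)]
  have h2 := Real.pow_div_factorial_le_exp (a * r ^ 2) (by positivity) m
  rw [mul_pow, div_le_iff₀ (by positivity)] at h2
  have h3 : (r ^ 2) ^ m ≤ m.factorial / a ^ m * Real.exp (a * r ^ 2) := by
    rw [div_mul_eq_mul_div, le_div_iff₀ (by positivity)]
    linarith
  have h4 : 1 ≤ Real.exp (a * r ^ 2) := Real.one_le_exp (by positivity)
  rw [neg_mul, Real.exp_neg, ← div_eq_mul_inv, div_le_iff₀ (Real.exp_pos _)]
  linarith

lemma summable_pow_mul_exp (L : Submodule ℤ (EuclideanSpace ℝ (Fin n))) [DiscreteTopology L]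
    (k : ℕ) {a : ℝ} (ha : 0 < a) :
    Summable fun x : {x : EuclideanSpace ℝ (Fin n) // x ∈ L ∧ x ≠ 0} ↦
      ‖x.1‖ ^ k * Real.exp (-a * ‖x.1‖ ^ 2) := by
  have h := ZLattice.summable_norm_pow_inv L (Module.finrank ℤ L + 1) (Nat.lt_succ_self _)
  set N := Module.finrank ℤ L + 1
  let j : {x : EuclideanSpace ℝ (Fin n) // x ∈ L ∧ x ≠ 0} → L := fun x ↦ ⟨x.1, x.2.1⟩
  have hj : Function.Injective j := fun x y hxy ↦ Subtype.ext (congrArg (fun z : L ↦ z.1) hxy)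
  have h2 := h.comp_injective hj
  obtain ⟨K, hK⟩ := exists_pow_mul_exp_le (k + N) ha
  refine Summable.of_nonneg_of_le (fun x ↦ by positivity) (fun x ↦ ?_) (h2.mul_left K)
  have hx : 0 < ‖x.1‖ := norm_pos_iff.2 x.2.2
  have h3 := hK ‖x.1‖ hx.le
  change _ ≤ K * ‖x.1‖⁻¹ ^ N
  rw [inv_pow, ← div_eq_mul_inv, le_div_iff₀ (by positivity)]
  rw [pow_add] at h3
  linarith

/-- Reindexing by x ↦ Ax moves the dependence on A from the index set into the summand, where it
enters only through the Gram matrix. -/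
lemma energy_transform (L : Submodule ℤ (EuclideanSpace ℝ (Fin n))) (α : ℝ)
    {A : Matrix (Fin n) (Fin n) ℝ} (hA : IsUnit A.det) :
    energy (gaussian α) (transform A L) =
      ∑' x : {x : EuclideanSpace ℝ (Fin n) // x ∈ L ∧ x ≠ 0},
        Real.exp (-α * (‖x.1‖ ^ 2 + quad (Aᵀ * A - 1) x.1)) := by
  have hinj : Function.Injective (Matrix.toEuclideanLin A) := by
    intro x y hxy
    have h := congrArg (fun z ↦ A⁻¹.mulVec (WithLp.ofLp z)) hxy
    simp only [Matrix.toLpLin_apply, Matrix.mulVec_mulVec, Matrix.nonsing_inv_mul _ hA,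
      Matrix.one_mulVec] at h
    exact WithLp.ofLp_injective _ h
  let e : {x : EuclideanSpace ℝ (Fin n) // x ∈ L ∧ x ≠ 0} →
      {y : EuclideanSpace ℝ (Fin n) // y ∈ transform A L ∧ y ≠ 0} := fun x ↦
    ⟨Matrix.toEuclideanLin A x.1, Submodule.mem_map_of_mem x.2.1,
      fun h ↦ x.2.2 (hinj (by rw [h, map_zero]))⟩
  have he : Function.Bijective e := by
    refine ⟨fun x y hxy ↦ Subtype.ext (hinj (congrArg Subtype.val hxy)), ?_⟩
    rintro ⟨y, ⟨x, hx, rfl⟩, hy⟩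
    exact ⟨⟨x, hx, fun h ↦ hy (by rw [h, map_zero])⟩, rfl⟩
  rw [energy, ← (Equiv.ofBijective e he).tsum_eq]
  refine tsum_congr fun x ↦ ?_
  have h : ‖((Equiv.ofBijective e he) x).1‖ ^ 2 = ‖x.1‖ ^ 2 + quad (Aᵀ * A - 1) x.1 := by
    rw [quad_sub, quad_one, ← norm_sq_toEuclideanLin]
    change ‖Matrix.toEuclideanLin A x.1‖ ^ 2 = _
    ring
  rw [gaussian, h]

/-- The sum `∑ e^{-α ‖x‖²} H[x]` over the nonzero vectors of `L`. -/
noncomputable def gaussianMoment (L : Submodule ℤ (EuclideanSpace ℝ (Fin n))) (α : ℝ)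
    (H : Matrix (Fin n) (Fin n) ℝ) : ℝ :=
  ∑' x : {x : EuclideanSpace ℝ (Fin n) // x ∈ L ∧ x ≠ 0}, Real.exp (-α * ‖x.1‖ ^ 2) * quad H x.1

lemma gaussianMoment_smul (L : Submodule ℤ (EuclideanSpace ℝ (Fin n))) (α c : ℝ) (H : Matrix (Fin n) (Fin n) ℝ) :
    gaussianMoment L α (c • H) = c * gaussianMoment L α H := by
  rw [gaussianMoment, gaussianMoment, ← tsum_mul_left]
  exact tsum_congr fun x ↦ by rw [quad_smul]; ring

variable (L : Submodule ℤ (EuclideanSpace ℝ (Fin n))) [DiscreteTopology L]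

lemma summable_exp_mul_quad {α : ℝ} (hα : 0 < α) (H : Matrix (Fin n) (Fin n) ℝ) :
    Summable fun x : {x : EuclideanSpace ℝ (Fin n) // x ∈ L ∧ x ≠ 0} ↦
      Real.exp (-α * ‖x.1‖ ^ 2) * quad H x.1 := by
  refine Summable.of_norm_bounded ((summable_pow_mul_exp L 2 hα).mul_left ‖H‖) fun x ↦ ?_
  rw [Real.norm_eq_abs, abs_mul, abs_of_pos (Real.exp_pos _)]
  have := mul_le_mul_of_nonneg_left (abs_quad_le H x.1) (Real.exp_pos (-α * ‖x.1‖ ^ 2)).le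
  linarith

lemma gaussianMoment_add {α : ℝ} (hα : 0 < α) (G H : Matrix (Fin n) (Fin n) ℝ) :
    gaussianMoment L α (G + H) = gaussianMoment L α G + gaussianMoment L α H := by
  rw [gaussianMoment, gaussianMoment, gaussianMoment,
    ← (summable_exp_mul_quad L hα G).tsum_add (summable_exp_mul_quad L hα H)]
  exact tsum_congr fun x ↦ by rw [quad_add]; ring

lemma abs_gaussianMoment_le {α : ℝ} (hα : 0 < α) (H : Matrix (Fin n) (Fin n) ℝ) :
    |gaussianMoment L α H| ≤ ‖H‖ * gaussianMoment L α 1 := by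
  rw [gaussianMoment, gaussianMoment, ← tsum_mul_left, ← Real.norm_eq_abs]
  refine tsum_of_norm_bounded ((summable_exp_mul_quad L hα 1).mul_left ‖H‖).hasSum fun x ↦ ?_
  rw [Real.norm_eq_abs, abs_mul, abs_of_pos (Real.exp_pos _), quad_one]
  have := mul_le_mul_of_nonneg_left (abs_quad_le H x.1) (Real.exp_pos (-α * ‖x.1‖ ^ 2)).le
  linarith

lemma summable_exp_add_quad {α : ℝ} (hα : 0 < α) {S : Matrix (Fin n) (Fin n) ℝ}
    (hS : ‖S‖ ≤ 1 / 2) :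
    Summable fun x : {x : EuclideanSpace ℝ (Fin n) // x ∈ L ∧ x ≠ 0} ↦
      Real.exp (-α * (‖x.1‖ ^ 2 + quad S x.1)) := by
  refine Summable.of_nonneg_of_le (fun x ↦ (Real.exp_pos _).le) (fun x ↦ ?_)
    (summable_pow_mul_exp L 0 (half_pos hα))
  rw [pow_zero, one_mul]
  apply Real.exp_le_exp.2
  have h1 := (abs_le.1 (abs_quad_le S x.1)).1
  have h2 := mul_le_mul_of_nonneg_right hS (sq_nonneg ‖x.1‖)
  nlinarith

/-- The convexity remainder of the energy, as a sum of nonnegative terms. -/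
lemma hasSum_energy_sub {α : ℝ} (hα : 0 < α) {A : Matrix (Fin n) (Fin n) ℝ} (hA : IsUnit A.det)
    (hS : ‖Aᵀ * A - 1‖ ≤ 1 / 2) :
    HasSum (fun x : {x : EuclideanSpace ℝ (Fin n) // x ∈ L ∧ x ≠ 0} ↦
      Real.exp (-α * ‖x.1‖ ^ 2) * (Real.exp (-α * quad (Aᵀ * A - 1) x.1) - 1 -
        -α * quad (Aᵀ * A - 1) x.1))
      (energy (gaussian α) (transform A L) - energy (gaussian α) (transform 1 L) +
        α * gaussianMoment L α (Aᵀ * A - 1)) := by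
  have h1 := (summable_exp_add_quad L hα hS).hasSum
  have h0 := (summable_exp_add_quad L hα
    (S := (1 : Matrix (Fin n) (Fin n) ℝ)ᵀ * 1 - 1) (by simp)).hasSum
  have hm := ((summable_exp_mul_quad L hα (Aᵀ * A - 1)).hasSum).mul_left α
  rw [← energy_transform L α hA] at h1
  rw [← energy_transform L α (by simp)] at h0
  refine ((h1.sub h0).add hm).congr_fun ?_
  intro x
  have : (1 : Matrix (Fin n) (Fin n) ℝ)ᵀ * 1 - 1 = 0 := by simp
  rw [this]
  have hq : quad (0 : Matrix (Fin n) (Fin n) ℝ) x.1 = 0 := by simp [quad]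
  rw [hq, mul_add, Real.exp_add]
  ring_nf

lemma neg_gaussianMoment_le_energy_sub {α : ℝ} (hα : 0 < α) {A : Matrix (Fin n) (Fin n) ℝ}
    (hA : IsUnit A.det) (hS : ‖Aᵀ * A - 1‖ ≤ 1 / 2) :
    -α * gaussianMoment L α (Aᵀ * A - 1) ≤
      energy (gaussian α) (transform A L) - energy (gaussian α) (transform 1 L) := by
  have h := (hasSum_energy_sub L hα hA hS).nonneg fun x ↦ by
    have := Real.add_one_le_exp (-α * quad (Aᵀ * A - 1) x.1)
    exact mul_nonneg (Real.exp_pos _).le (by linarith)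
  linarith

end Energy

/-! ### What criticality says about the Gaussian moment -/

section Critical

variable {n : ℕ} (L : Submodule ℤ (EuclideanSpace ℝ (Fin n))) [DiscreteTopology L]

lemma isUnit_det_exp (H : Matrix (Fin n) (Fin n) ℝ) : IsUnit (NormedSpace.exp H).det :=
  (Matrix.isUnit_iff_isUnit_det _).mp (Matrix.isUnit_exp _)

lemma eventually_norm_gram_exp_le {H : Matrix (Fin n) (Fin n) ℝ} (hs : H.IsSymm) {ε : ℝ}
    (hε : 0 < ε) :
    ∀ᶠ t : ℝ in 𝓝 0, ‖(NormedSpace.exp (t • H))ᵀ * NormedSpace.exp (t • H) - 1‖ ≤ ε := by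
  obtain ⟨C, hC, h⟩ := exists_gram_exp_bound hs
  have h1 : ∀ᶠ t : ℝ in 𝓝 0, C * |t| < ε := by
    have hc : Continuous fun t : ℝ ↦ C * |t| := by fun_prop
    exact (hc.tendsto 0).eventually_lt_const (by simpa using hε)
  filter_upwards [h, h1] with t h2 h3
  exact h2.2.trans h3.le

lemma gaussianMoment_gram_exp_sub_isBigO {α : ℝ} (hα : 0 < α) {H : Matrix (Fin n) (Fin n) ℝ}
    (hs : H.IsSymm) :
    (fun t : ℝ ↦ gaussianMoment L α ((NormedSpace.exp (t • H))ᵀ * NormedSpace.exp (t • H) - 1) -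
      t * (2 * gaussianMoment L α H)) =O[𝓝 0] fun t ↦ t ^ 2 := by
  obtain ⟨C, hC, h⟩ := exists_gram_exp_bound hs
  refine Asymptotics.IsBigO.of_bound (C * gaussianMoment L α 1) ?_
  filter_upwards [h] with t ht
  have h1 := abs_gaussianMoment_le L hα
    ((NormedSpace.exp (t • H))ᵀ * NormedSpace.exp (t • H) - 1 - (2 * t) • H)
  have h2 : gaussianMoment L α
      ((NormedSpace.exp (t • H))ᵀ * NormedSpace.exp (t • H) - 1 - (2 * t) • H) =
      gaussianMoment L α ((NormedSpace.exp (t • H))ᵀ * NormedSpace.exp (t • H) - 1) -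
      t * (2 * gaussianMoment L α H) := by
    rw [sub_eq_add_neg _ ((2 * t) • H), ← neg_smul, gaussianMoment_add L hα, gaussianMoment_smul]
    ring
  have h0 : 0 ≤ gaussianMoment L α 1 := tsum_nonneg fun x ↦ by
    rw [quad_one]; positivity
  rw [← h2, Real.norm_eq_abs, Real.norm_eq_abs, abs_of_nonneg (sq_nonneg t)]
  nlinarith [ht.1]

/-- No termwise differentiation of the energy is needed. By convexity, energy plus α times the
moment of S has a local minimum at t = 0 along exp(tH); by criticality its derivative there is 2α
M(H), which must therefore vanish. -/
lemma gaussianMoment_eq_zero_of_isCritical {α : ℝ} (hα : 0 < α)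
    (hcrit : IsCritical (gaussian α) L) {H : Matrix (Fin n) (Fin n) ℝ} (hs : H.IsSymm)
    (htr : H.trace = 0) : gaussianMoment L α H = 0 := by
  have hz : gaussianMoment L α 0 = 0 := by simpa using gaussianMoment_smul L α 0 0
  have hd : HasDerivAt (fun t : ℝ ↦ gaussianMoment L α
      ((NormedSpace.exp (t • H))ᵀ * NormedSpace.exp (t • H) - 1)) (2 * gaussianMoment L α H) 0 := by
    rw [hasDerivAt_iff_isLittleO]
    have := (gaussianMoment_gram_exp_sub_isBigO L hα hs).trans_isLittleO
      (Asymptotics.isLittleO_pow_id one_lt_two)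
    refine (this.congr_left fun t ↦ ?_).congr_right fun t ↦ ?_
    · simp [hz]
    · simp
  have hg := (hcrit H htr).add (hd.const_mul α)
  have hmin : IsLocalMin ((fun t : ℝ ↦ energy (gaussian α) (transform (NormedSpace.exp (t • H)) L))
      + fun t ↦ α * gaussianMoment L α
      ((NormedSpace.exp (t • H))ᵀ * NormedSpace.exp (t • H) - 1)) 0 := by
    filter_upwards [eventually_norm_gram_exp_le hs one_half_pos] with t ht
    have := neg_gaussianMoment_le_energy_sub L hα (isUnit_det_exp (t • H)) ht
    simp only [Pi.add_apply, zero_smul, NormedSpace.exp_zero, Matrix.transpose_one, mul_one,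
      sub_self, hz, mul_zero, add_zero]
    linarith
  have := hmin.hasDerivAt_eq_zero hg
  rw [zero_add] at this
  have h2 : α * 2 * gaussianMoment L α H = 0 := by linarith
  exact (mul_eq_zero.1 h2).resolve_left (by positivity)

lemma gaussianMoment_of_isCritical [NeZero n] {α : ℝ} (hα : 0 < α)
    (hcrit : IsCritical (gaussian α) L) {H : Matrix (Fin n) (Fin n) ℝ} (hs : H.IsSymm) :
    gaussianMoment L α H = H.trace / n * gaussianMoment L α 1 := by
  have hn : (n : ℝ) ≠ 0 := Nat.cast_ne_zero.2 (NeZero.ne n)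
  have h := gaussianMoment_eq_zero_of_isCritical L hα hcrit
    (H := H + (-(H.trace / n)) • (1 : Matrix (Fin n) (Fin n) ℝ))
    (by simp [Matrix.IsSymm, hs.eq])
    (by simp [Matrix.trace_add, Matrix.trace_smul])
  rw [gaussianMoment_add L hα, gaussianMoment_smul] at h
  linarith

end Critical

/-! ### The gap between norms 2 and 4, and bounds uniform in α -/

section Even

variable {n : ℕ} {L : Submodule ℤ (EuclideanSpace ℝ (Fin n))}

lemma IsEven.norm_sq_cases (heven : IsEven L) {x : EuclideanSpace ℝ (Fin n)} (hx : x ∈ L)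
    (h0 : x ≠ 0) : ‖x‖ ^ 2 = 2 ∨ 4 ≤ ‖x‖ ^ 2 := by
  obtain ⟨k, hk⟩ := heven x hx
  rw [real_inner_self_eq_norm_sq] at hk
  have hpos : 0 < ‖x‖ ^ 2 := by positivity
  rw [hk] at hpos ⊢
  have hk0 : 0 < k := by
    have : (0 : ℝ) < k := by linarith
    exact_mod_cast this
  rcases (show k = 1 ∨ 2 ≤ k by lia) with rfl | h
  · left; norm_num
  · right
    have : (2 : ℝ) ≤ k := by exact_mod_cast h
    linarith

lemma mem_shell_two_iff {x : EuclideanSpace ℝ (Fin n)} : x ∈ shell L 2 ↔ x ∈ L ∧ ‖x‖ ^ 2 = 2 := by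
  rw [shell, Set.mem_ofPred_eq, real_inner_self_eq_norm_sq]

lemma ne_zero_of_mem_shell {x : EuclideanSpace ℝ (Fin n)} (hx : x ∈ shell L 2) : x ≠ 0 := by
  rintro rfl
  have := (mem_shell_two_iff.1 hx).2
  norm_num at this

lemma finite_shell [DiscreteTopology L] (s : ℝ) : (shell L s).Finite := by
  have hcl : IsClosed (L : Set (EuclideanSpace ℝ (Fin n))) :=
    @AddSubgroup.isClosed_of_discrete _ _ _ _ _ L.toAddSubgroup _
  have hb : Bornology.IsBounded {x : EuclideanSpace ℝ (Fin n) | ‖x‖ ^ 2 ≤ s} := by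
    refine (Metric.isBounded_closedBall (x := (0 : EuclideanSpace ℝ (Fin n))) (r := 1 + s)).subset
      fun x hx ↦ ?_
    rw [mem_closedBall_zero_iff]
    simp only [Set.mem_ofPred_eq] at hx
    nlinarith [sq_nonneg (‖x‖ - 1)]
  refine (Metric.finite_isBounded_inter_isClosed (SetLike.isDiscrete_iff_discreteTopology.2 ‹_›) hb hcl).subset
    fun x hx ↦ ⟨?_, hx.1⟩
  have := hx.2
  rw [real_inner_self_eq_norm_sq] at this
  exact this.le

/-- One factor e^{-r} is kept for summability and the rest is bounded at the smallest norm m, so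
that the remaining lattice sum does not depend on α. -/
lemma exp_neg_mul_le {β m r : ℝ} (hβ : 1 ≤ β) (hr : m ≤ r) :
    Real.exp (-β * r) ≤ Real.exp (-(β - 1) * m) * Real.exp (-1 * r) := by
  rw [← Real.exp_add]
  apply Real.exp_le_exp.2
  nlinarith

/-- The majorant `∑ ‖x‖⁴ e^{-‖x‖²}` used to bound all lattice sums. -/
noncomputable def majorant (L : Submodule ℤ (EuclideanSpace ℝ (Fin n))) : ℝ :=
  ∑' x : {x : EuclideanSpace ℝ (Fin n) // x ∈ L ∧ x ≠ 0}, ‖x.1‖ ^ 4 * Real.exp (-1 * ‖x.1‖ ^ 2)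

lemma majorant_nonneg (L : Submodule ℤ (EuclideanSpace ℝ (Fin n))) : 0 ≤ majorant L :=
  tsum_nonneg fun _ ↦ by positivity

lemma IsEven.two_le_norm_sq (heven : IsEven L)
    (x : {x : EuclideanSpace ℝ (Fin n) // x ∈ L ∧ x ≠ 0}) : 2 ≤ ‖x.1‖ ^ 2 := by
  rcases heven.norm_sq_cases x.2.1 x.2.2 with h | h <;> linarith

variable [DiscreteTopology L]

lemma IsEven.gaussianMoment_one_le (heven : IsEven L) {α : ℝ} (hα : 1 ≤ α) :
    gaussianMoment L α 1 ≤ Real.exp 2 * majorant L * Real.exp (-2 * α) := by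
  have hs := (summable_pow_mul_exp L 4 one_pos).mul_left (Real.exp (-(α - 1) * 2))
  have h := (summable_exp_mul_quad L (by linarith : 0 < α) 1).tsum_le_tsum (fun x ↦ ?_) hs
  · rw [tsum_mul_left] at h
    calc _ ≤ _ := h
      _ = Real.exp (-(α - 1) * 2) * majorant L := rfl
      _ = _ := by
        rw [mul_right_comm, ← Real.exp_add]
        ring_nf
  · have h2 := heven.two_le_norm_sq x
    rw [quad_one]
    have h3 := exp_neg_mul_le hα h2
    have h4 : ‖x.1‖ ^ 2 ≤ ‖x.1‖ ^ 4 := by nlinarith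
    calc _ ≤ Real.exp (-(α - 1) * 2) * Real.exp (-1 * ‖x.1‖ ^ 2) * ‖x.1‖ ^ 4 := by gcongr
      _ = _ := by ring

lemma le_gaussianMoment_one {α : ℝ} (hα : 0 < α) {x : EuclideanSpace ℝ (Fin n)}
    (hx : x ∈ shell L 2) : 2 * Real.exp (-2 * α) ≤ gaussianMoment L α 1 := by
  have h := (summable_exp_mul_quad L hα 1).le_tsum
    ⟨x, (mem_shell_two_iff.1 hx).1, ne_zero_of_mem_shell hx⟩ fun y _ ↦ by
      rw [quad_one]; positivity
  rw [quad_one, (mem_shell_two_iff.1 hx).2] at h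
  calc _ = Real.exp (-α * 2) * 2 := by ring_nf
    _ ≤ _ := h

/-- The roots contribute nothing, so the sum effectively starts at squared norm 4. -/
lemma IsEven.abs_gaussianMoment_le_of_shell (heven : IsEven L) {α : ℝ} (hα : 1 ≤ α)
    {H : Matrix (Fin n) (Fin n) ℝ} (hH : ∀ x ∈ shell L 2, quad H x = 0) :
    |gaussianMoment L α H| ≤ Real.exp 4 * ‖H‖ * majorant L * Real.exp (-4 * α) := by
  have hs := (summable_pow_mul_exp L 4 one_pos).mul_left (Real.exp (-(α - 1) * 4) * ‖H‖)
  have h := tsum_of_norm_bounded hs.hasSum (f := fun x ↦ Real.exp (-α * ‖x.1‖ ^ 2) * quad H x.1)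
    fun x ↦ ?_
  · rw [tsum_mul_left, Real.norm_eq_abs] at h
    calc _ ≤ _ := h
      _ = Real.exp (-(α - 1) * 4) * ‖H‖ * majorant L := rfl
      _ = (Real.exp 4 * Real.exp (-4 * α)) * ‖H‖ * majorant L := by
        rw [← Real.exp_add]
        ring_nf
      _ = _ := by ring
  · rw [Real.norm_eq_abs, abs_mul, abs_of_pos (Real.exp_pos _)]
    rcases heven.norm_sq_cases x.2.1 x.2.2 with h2 | h2
    · rw [hH x.1 (mem_shell_two_iff.2 ⟨x.2.1, h2⟩)]
      simp only [abs_zero, mul_zero]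
      positivity
    · have h3 := exp_neg_mul_le hα h2
      have h4 : ‖x.1‖ ^ 2 ≤ ‖x.1‖ ^ 4 := by nlinarith
      have h5 : |quad H x.1| ≤ ‖H‖ * ‖x.1‖ ^ 4 := (abs_quad_le H x.1).trans (by gcongr)
      calc _ ≤ (Real.exp (-(α - 1) * 4) * Real.exp (-1 * ‖x.1‖ ^ 2)) * (‖H‖ * ‖x.1‖ ^ 4) := by
            gcongr
        _ = _ := by ring

/-- The Taylor coefficient 1/2 loses at most 2/9 to the cubic error, and 1/2 - 2/9 > 1/4. -/
lemma sq_div_four_le_exp {u : ℝ} (hu : |u| ≤ 1) : u ^ 2 / 4 ≤ Real.exp u - 1 - u := by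
  have h := (abs_le.1 (Real.exp_bound hu (n := 3) (by norm_num))).1
  norm_num [Finset.sum_range_succ, Nat.factorial] at h
  have h3 : |u| ^ 3 ≤ u ^ 2 := by
    rw [← sq_abs]
    exact pow_le_pow_of_le_one (abs_nonneg u) hu (by norm_num)
  nlinarith [sq_nonneg u]

/-- All remainder terms are nonnegative, so a single root may be kept and the others dropped. As
‖x‖² = 2, the bound `hu` brings α S[x] into the range of the quadratic estimate. -/
lemma le_energy_sub_of_mem_shell {α : ℝ} (hα : 0 < α) {A : Matrix (Fin n) (Fin n) ℝ}
    (hA : IsUnit A.det) (hS : ‖Aᵀ * A - 1‖ ≤ 1 / 2) {x : EuclideanSpace ℝ (Fin n)}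
    (hx : x ∈ shell L 2) (hu : 2 * α * ‖Aᵀ * A - 1‖ ≤ 1) :
    Real.exp (-2 * α) * (α ^ 2 * quad (Aᵀ * A - 1) x ^ 2 / 4) - α * gaussianMoment L α (Aᵀ * A - 1)
      ≤ energy (gaussian α) (transform A L) - energy (gaussian α) (transform 1 L) := by
  have hx2 := (mem_shell_two_iff.1 hx).2
  have h := hasSum_energy_sub L hα hA hS
  have h1 := le_hasSum h ⟨x, (mem_shell_two_iff.1 hx).1, ne_zero_of_mem_shell hx⟩ fun y _ ↦ by
    have := Real.add_one_le_exp (-α * quad (Aᵀ * A - 1) y)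
    exact mul_nonneg (Real.exp_pos _).le (by linarith)
  have h2 : |-α * quad (Aᵀ * A - 1) x| ≤ 1 := by
    rw [abs_mul, abs_neg, abs_of_pos hα]
    have := abs_quad_le (Aᵀ * A - 1) x
    rw [hx2] at this
    nlinarith
  have h3 := mul_le_mul_of_nonneg_left (sq_div_four_le_exp h2) (Real.exp_pos (-α * 2)).le
  simp only [hx2] at h1
  have h4 : Real.exp (-2 * α) * (α ^ 2 * quad (Aᵀ * A - 1) x ^ 2 / 4) =
    Real.exp (-α * 2) * ((-α * quad (Aᵀ * A - 1) x) ^ 2 / 4) := by ring_nf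
  linarith

end Even

/-! ### Minima, maxima and criticality for large α -/

section Extrema

variable {n : ℕ} {L : Submodule ℤ (EuclideanSpace ℝ (Fin n))}

lemma tendsto_exp_smul {H : Matrix (Fin n) (Fin n) ℝ} (hs : H.IsSymm) (htr : H.trace = 0) :
    Tendsto (fun t : ℝ ↦ NormedSpace.exp (t • H)) (𝓝 0)
      (𝓝[{A : Matrix (Fin n) (Fin n) ℝ | A.det = 1}] 1) := by
  refine tendsto_nhdsWithin_iff.2 ⟨?_, Eventually.of_forall fun t ↦ ?_⟩
  · have h := (hasDerivAt_exp_smul_const (𝕂 := ℝ) H (0 : ℝ)).continuousAt.tendsto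
    simpa using h
  · have hs' : (t • H).IsSymm := by simp [Matrix.IsSymm, hs.eq]
    change (NormedSpace.exp (t • H)).det = 1
    rw [det_exp_of_isSymm hs', Matrix.trace_smul, htr, smul_zero, Real.exp_zero]

lemma trace_gram_exp_le {H : Matrix (Fin n) (Fin n) ℝ} (htr : H.trace = 0) {C t : ℝ}
    (ht : ‖(NormedSpace.exp (t • H))ᵀ * NormedSpace.exp (t • H) - 1 - (2 * t) • H‖ ≤ C * t ^ 2) :
    ((NormedSpace.exp (t • H))ᵀ * NormedSpace.exp (t • H) - 1).trace ≤ n * (C * t ^ 2) := by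
  have h := (le_abs_self _).trans (abs_trace_le
    ((NormedSpace.exp (t • H))ᵀ * NormedSpace.exp (t • H) - 1 - (2 * t) • H))
  rw [Matrix.trace_sub _ ((2 * t) • H), Matrix.trace_smul, htr, smul_zero, sub_zero] at h
  exact h.trans (by gcongr)

variable [DiscreteTopology L]

/-- A traceless direction that does not vanish on the roots increases the energy for large `α`. -/
lemma IsEven.eventually_not_isLocalMaximum [NeZero n] (heven : IsEven L)
    {G : Matrix (Fin n) (Fin n) ℝ} (hs : G.IsSymm) (htr : G.trace = 0)
    {x : EuclideanSpace ℝ (Fin n)} (hx : x ∈ shell L 2) (hγ : 0 < quad G x) :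
    ∀ᶠ α : ℝ in atTop, IsCritical (gaussian α) L → ¬ IsLocalMaximum (gaussian α) L := by
  obtain ⟨C, hC, hexp⟩ := exists_gram_exp_bound hs
  set D := Real.exp 2 * majorant L
  have hn : (0 : ℝ) < n := Nat.cast_pos.2 (Nat.pos_of_ne_zero (NeZero.ne n))
  have hx2 := (mem_shell_two_iff.1 hx).2
  -- Gain α² e^{-2α} t² G[x]²/4 against loss α e^{-2α} t² C D, divided by α e^{-2α} t². The
  -- threshold for α is free of t, while t may afterwards be chosen depending on α.
  have hlarge : ∀ᶠ α : ℝ in atTop, C * D < α * (quad G x ^ 2 / 4) :=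
    (tendsto_id.atTop_mul_const (by positivity)).eventually_gt_atTop _
  filter_upwards [hlarge, eventually_ge_atTop 1] with α hα hα1 hcrit hmax
  have hα0 : 0 < α := by linarith
  have h1 : ∀ᶠ t : ℝ in 𝓝 0, ‖(NormedSpace.exp (t • G))ᵀ * NormedSpace.exp (t • G) - 1‖ ≤
      min (1 / 2) (1 / (2 * α)) := eventually_norm_gram_exp_le hs (by positivity)
  have h2 : ∀ᶠ t : ℝ in 𝓝 0, 2 * C * t < quad G x := by
    have hc : Continuous fun t : ℝ ↦ 2 * C * t := by fun_prop
    exact (hc.tendsto 0).eventually_lt_const (by simpa using hγ)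
  have h3 := (tendsto_exp_smul hs htr).eventually hmax
  obtain ⟨t, ⟨⟨⟨ht1, ht2⟩, ht3⟩, ht4⟩, ht0⟩ :=
    (((((hexp.and h1).and h2).and h3).filter_mono nhdsWithin_le_nhds).and
      (self_mem_nhdsWithin (a := (0 : ℝ)) (s := Set.Ioi 0))).exists
  replace ht0 : 0 < t := ht0
  have h4 := le_energy_sub_of_mem_shell hα0 (isUnit_det_exp (t • G)) (ht2.trans (min_le_left _ _))
    hx (by
      have := ht2.trans (min_le_right _ _)
      rw [le_div_iff₀ (by positivity)] at this
      linarith)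
  rw [gaussianMoment_of_isCritical L hα0 hcrit (isSymm_transpose_mul_sub_one _)] at h4
  have h5 := trace_gram_exp_le htr ht1.1
  have h6 := heven.gaussianMoment_one_le hα1
  have h7 := le_gaussianMoment_one hα0 hx
  set S := (NormedSpace.exp (t • G))ᵀ * NormedSpace.exp (t • G) - 1
  set m := gaussianMoment L α 1
  -- S[x] is 2t G[x] with error at most 2C t², and 2C t < G[x].
  have h8 : t * quad G x ≤ quad S x := by
    have h := (abs_le.1 (abs_quad_le (S - (2 * t) • G) x)).1
    rw [quad_sub, quad_smul, hx2] at h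
    nlinarith [ht1.1]
  have hm : 0 ≤ m := le_trans (by positivity) h7
  have h9 : S.trace / n * m ≤ (C * t ^ 2) * (D * Real.exp (-2 * α)) := by
    have : S.trace / n ≤ C * t ^ 2 := by
      rw [div_le_iff₀ hn]; linarith
    calc _ ≤ (C * t ^ 2) * m := by gcongr
      _ ≤ _ := by gcongr
  have h10 : t ^ 2 * quad G x ^ 2 ≤ quad S x ^ 2 := by
    rw [← mul_pow]; gcongr
  have h11 : Real.exp (-2 * α) * (α ^ 2 * (t ^ 2 * quad G x ^ 2) / 4) ≤
    Real.exp (-2 * α) * (α ^ 2 * quad S x ^ 2 / 4) := by gcongr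
  have h12 := mul_le_mul_of_nonneg_left h9 hα0.le
  have h13 : 0 < (α * t ^ 2 * Real.exp (-2 * α)) * (α * (quad G x ^ 2 / 4) - C * D) :=
    mul_pos (by positivity) (by linarith)
  have h14 : energy (gaussian α) (transform (NormedSpace.exp (t • G)) L) ≤
    energy (gaussian α) (transform 1 L) := ht4
  linarith

/-- If the roots control all symmetric matrices, critical points are minima for large `α`. -/
lemma IsEven.eventually_isLocalMinimum [NeZero n] (heven : IsEven L)
    {κ : ℝ} (hκ : 0 < κ)
    (hQ : ∀ S : Matrix (Fin n) (Fin n) ℝ, S.IsSymm → ∃ x ∈ shell L 2, κ * ‖S‖ ≤ |quad S x|) :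
    ∀ᶠ α : ℝ in atTop, IsCritical (gaussian α) L → IsLocalMinimum (gaussian α) L := by
  set D := Real.exp 2 * majorant L
  have hn : (0 : ℝ) < n := Nat.cast_pos.2 (Nat.pos_of_ne_zero (NeZero.ne n))
  -- The same comparison with ‖S‖ in place of t; the 2 is the constant of `trace_sub_one_le`.
  have hlarge : ∀ᶠ α : ℝ in atTop, 2 * D < α * (κ ^ 2 / 4) :=
    (tendsto_id.atTop_mul_const (by positivity)).eventually_gt_atTop _
  filter_upwards [hlarge, eventually_ge_atTop 1] with α hα hα1 hcrit
  have hα0 : 0 < α := by linarith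
  have hcont : Continuous fun A : Matrix (Fin n) (Fin n) ℝ ↦ ‖Aᵀ * A - 1‖ := by fun_prop
  have hnear : ∀ᶠ A : Matrix (Fin n) (Fin n) ℝ in 𝓝 1,
      ‖Aᵀ * A - 1‖ < min (1 / 2) (1 / (2 * α)) :=
    (hcont.tendsto 1).eventually_lt_const (by simp; positivity)
  filter_upwards [nhdsWithin_le_nhds hnear, self_mem_nhdsWithin] with A hA hdet
  replace hdet : A.det = 1 := hdet
  have hS1 : ‖Aᵀ * A - 1‖ ≤ 1 / 2 := hA.le.trans (min_le_left _ _)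
  obtain ⟨x, hx, hxS⟩ := hQ _ (isSymm_transpose_mul_sub_one A)
  have h4 := le_energy_sub_of_mem_shell hα0 (by simp [hdet]) hS1 hx (by
      have := hA.le.trans (min_le_right _ _)
      rw [le_div_iff₀ (by positivity)] at this
      linarith)
  rw [gaussianMoment_of_isCritical L hα0 hcrit (isSymm_transpose_mul_sub_one _)] at h4
  have h5 := trace_sub_one_le (P := Aᵀ * A) (by simp [Matrix.IsSymm]) (by simp [hdet]) hS1
  have h6 := heven.gaussianMoment_one_le hα1
  have h7 := le_gaussianMoment_one hα0 hx
  set S := Aᵀ * A - 1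
  set m := gaussianMoment L α 1
  have hm : 0 ≤ m := le_trans (by positivity) h7
  have h9 : S.trace / n * m ≤ (2 * ‖S‖ ^ 2) * (D * Real.exp (-2 * α)) := by
    have : S.trace / n ≤ 2 * ‖S‖ ^ 2 := by
      rw [div_le_iff₀ hn]; linarith
    calc _ ≤ (2 * ‖S‖ ^ 2) * m := by gcongr
      _ ≤ _ := by gcongr
  have h10 : κ ^ 2 * ‖S‖ ^ 2 ≤ quad S x ^ 2 := by
    rw [← mul_pow, ← sq_abs (quad S x)]; gcongr
  have h11 : Real.exp (-2 * α) * (α ^ 2 * (κ ^ 2 * ‖S‖ ^ 2) / 4) ≤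
    Real.exp (-2 * α) * (α ^ 2 * quad S x ^ 2 / 4) := by gcongr
  have h12 := mul_le_mul_of_nonneg_left h9 hα0.le
  have h13 : 0 ≤ (α * ‖S‖ ^ 2 * Real.exp (-2 * α)) * (α * (κ ^ 2 / 4) - 2 * D) :=
    mul_nonneg (by positivity) (by linarith)
  linarith

lemma tendsto_mul_exp_neg : Tendsto (fun α : ℝ ↦ α * Real.exp (-α)) atTop (𝓝 0) := by
  simpa using Real.tendsto_pow_mul_exp_neg_atTop_nhds_zero 1

/-- A symmetric matrix that vanishes on the roots and is not traceless excludes criticality. -/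
lemma IsEven.eventually_not_isCritical [NeZero n] (heven : IsEven L)
    (hne : (shell L 2).Nonempty) {H : Matrix (Fin n) (Fin n) ℝ} (hs : H.IsSymm)
    (hH : ∀ x ∈ shell L 2, quad H x = 0) (htr : H.trace ≠ 0) :
    ∀ᶠ α : ℝ in atTop, ¬ IsCritical (gaussian α) L := by
  obtain ⟨x, hx⟩ := hne
  have hn : (0 : ℝ) < n := Nat.cast_pos.2 (Nat.pos_of_ne_zero (NeZero.ne n))
  have hlarge : ∀ᶠ α : ℝ in atTop,
      Real.exp 4 * ‖H‖ * majorant L * Real.exp (-α) < |H.trace| / n * 2 := by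
    refine Tendsto.eventually_lt_const (v := 0)
      (mul_pos (div_pos (abs_pos.2 htr) hn) two_pos) ?_
    simpa using (Real.tendsto_exp_neg_atTop_nhds_zero).const_mul (Real.exp 4 * ‖H‖ * majorant L)
  filter_upwards [hlarge, eventually_ge_atTop 1] with α hα hα1 hcrit
  have hα0 : 0 < α := by linarith
  have h1 := heven.abs_gaussianMoment_le_of_shell hα1 hH
  have h2 := le_gaussianMoment_one hα0 hx
  rw [gaussianMoment_of_isCritical L hα0 hcrit hs, abs_mul, abs_div, abs_of_pos hn,
    abs_of_nonneg (le_trans (by positivity) h2)] at h1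
  have h3 : |H.trace| / n * (2 * Real.exp (-2 * α)) ≤ |H.trace| / n * gaussianMoment L α 1 := by
    gcongr
  have h4 : Real.exp (-4 * α) ≤ Real.exp (-α) * Real.exp (-2 * α) := by
    rw [← Real.exp_add]; apply Real.exp_le_exp.2; linarith
  have h5 : Real.exp 4 * ‖H‖ * majorant L * Real.exp (-4 * α) ≤
      Real.exp 4 * ‖H‖ * majorant L * (Real.exp (-α) * Real.exp (-2 * α)) := by
    have := majorant_nonneg L
    gcongr
  have h6 := mul_lt_mul_of_pos_right hα (Real.exp_pos (-2 * α))
  linarith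

lemma exp_sub_one_sub_le (u : ℝ) : Real.exp u - 1 - u ≤ u ^ 2 * Real.exp |u| := by
  have h := Complex.norm_exp_sub_sum_le_norm_mul_exp (u : ℂ) 2
  have h2 : Complex.exp u - ∑ m ∈ Finset.range 2, (u : ℂ) ^ m / (m.factorial : ℂ) =
      ((Real.exp u - 1 - u : ℝ) : ℂ) := by
    simp [Finset.sum_range_succ, sub_sub]
  rw [h2, Complex.norm_real, Complex.norm_real, Real.norm_eq_abs, Real.norm_eq_abs, sq_abs] at h
  exact (le_abs_self _).trans h

/-- Upper bound for the energy along `t ↦ exp (t H)` when `H` vanishes on the roots. -/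
lemma IsEven.eventually_energy_gram_exp_le (heven : IsEven L)
    {H : Matrix (Fin n) (Fin n) ℝ} (hs : H.IsSymm) (hH : ∀ x ∈ shell L 2, quad H x = 0) :
    ∃ C > 0, ∀ α : ℝ, 2 ≤ α → ∀ᶠ t : ℝ in 𝓝 0,
      energy (gaussian α) (transform (NormedSpace.exp (t • H)) L) -
        energy (gaussian α) (transform 1 L) +
        α * gaussianMoment L α ((NormedSpace.exp (t • H))ᵀ * NormedSpace.exp (t • H) - 1) ≤
      α ^ 2 * C * t ^ 2 * (t ^ 2 + Real.exp (4 - 3 * α)) := by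
  obtain ⟨C, hC, hexp⟩ := exists_gram_exp_bound hs
  refine ⟨C ^ 2 * (majorant L + 1), by have := majorant_nonneg L; positivity, fun α hα ↦ ?_⟩
  have hα0 : 0 < α := by linarith
  -- With ‖S‖ ≤ 1/4 the remainder costs a factor e^{α‖x‖²/4}, leaving e^{-3α‖x‖²/4}. At squared norm
  -- 4 this is e^{-3α}, still smaller than the competing e^{-2α}.
  filter_upwards [hexp, eventually_norm_gram_exp_le hs (ε := 1 / 4) (by norm_num)] with t ht ht4
  have h1 := hasSum_energy_sub L hα0 (isUnit_det_exp (t • H)) (ht4.trans (by norm_num))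
  set S := (NormedSpace.exp (t • H))ᵀ * NormedSpace.exp (t • H) - 1
  have h2 := (summable_pow_mul_exp L 4 one_pos).hasSum.mul_left
    (α ^ 2 * C ^ 2 * t ^ 2 * (t ^ 2 + Real.exp (4 - 3 * α)))
  have h3 := hasSum_le (fun x ↦ ?_) h1 h2
  · change _ ≤ _ * majorant L at h3
    refine h3.trans ?_
    have : 0 ≤ α ^ 2 * C ^ 2 * t ^ 2 * (t ^ 2 + Real.exp (4 - 3 * α)) := by positivity
    linarith
  · have hq := abs_quad_le S x.1
    have hu : |-α * quad S x.1| = α * |quad S x.1| := by rw [abs_mul, abs_neg, abs_of_pos hα0]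
    have hq4 : |quad S x.1| ≤ 1 / 4 * ‖x.1‖ ^ 2 := hq.trans (by gcongr)
    have h4 : Real.exp (-α * ‖x.1‖ ^ 2) * (Real.exp (-α * quad S x.1) - 1 - -α * quad S x.1) ≤
        Real.exp (-(3 / 4 * α) * ‖x.1‖ ^ 2) * (α ^ 2 * quad S x.1 ^ 2) := by
      calc _ ≤ Real.exp (-α * ‖x.1‖ ^ 2) *
            ((-α * quad S x.1) ^ 2 * Real.exp (α * (1 / 4 * ‖x.1‖ ^ 2))) := by
            gcongr
            refine (exp_sub_one_sub_le _).trans ?_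
            rw [hu]
            gcongr
        _ = (Real.exp (-α * ‖x.1‖ ^ 2) * Real.exp (α * (1 / 4 * ‖x.1‖ ^ 2))) *
            (α ^ 2 * quad S x.1 ^ 2) := by ring
        _ = _ := by rw [← Real.exp_add]; ring_nf
    refine h4.trans ?_
    have hβ : 1 ≤ 3 / 4 * α := by linarith
    rcases heven.norm_sq_cases x.2.1 x.2.2 with hx | hx
    -- On a root the first-order part 2t H[x] vanishes, so its contribution to the remainder is
    -- O(t⁴).
    · have h5 : |quad S x.1| ≤ C * t ^ 2 * ‖x.1‖ ^ 2 := by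
        have h := abs_quad_le (S - (2 * t) • H) x.1
        rw [quad_sub, quad_smul, hH x.1 (mem_shell_two_iff.2 ⟨x.2.1, hx⟩), mul_zero, sub_zero] at h
        exact h.trans (by gcongr; exact ht.1)
      have h6 : quad S x.1 ^ 2 ≤ (C * t ^ 2 * ‖x.1‖ ^ 2) ^ 2 := by
        rw [← sq_abs]; gcongr
      have h7 : Real.exp (-(3 / 4 * α) * ‖x.1‖ ^ 2) ≤ Real.exp (-1 * ‖x.1‖ ^ 2) := by
        gcongr
      calc _ ≤ Real.exp (-1 * ‖x.1‖ ^ 2) * (α ^ 2 * (C * t ^ 2 * ‖x.1‖ ^ 2) ^ 2) := by gcongr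
        _ = α ^ 2 * C ^ 2 * t ^ 2 * (t ^ 2 + 0) * (‖x.1‖ ^ 4 * Real.exp (-1 * ‖x.1‖ ^ 2)) := by ring
        _ ≤ _ := by gcongr; positivity
    · have h5 : |quad S x.1| ≤ C * |t| * ‖x.1‖ ^ 2 := hq.trans (by gcongr; exact ht.2)
      have h6 : quad S x.1 ^ 2 ≤ (C * |t| * ‖x.1‖ ^ 2) ^ 2 := by
        rw [← sq_abs]; gcongr
      have h7 := exp_neg_mul_le hβ hx
      calc _ ≤ (Real.exp (-(3 / 4 * α - 1) * 4) * Real.exp (-1 * ‖x.1‖ ^ 2)) *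
            (α ^ 2 * (C * |t| * ‖x.1‖ ^ 2) ^ 2) := by gcongr
        _ = α ^ 2 * C ^ 2 * |t| ^ 2 * (0 + Real.exp (-(3 / 4 * α - 1) * 4)) *
            (‖x.1‖ ^ 4 * Real.exp (-1 * ‖x.1‖ ^ 2)) := by ring
        _ = α ^ 2 * C ^ 2 * t ^ 2 * (0 + Real.exp (4 - 3 * α)) *
            (‖x.1‖ ^ 4 * Real.exp (-1 * ‖x.1‖ ^ 2)) := by rw [sq_abs]; ring_nf
        _ ≤ _ := by gcongr; positivity

/-- A traceless direction that vanishes on the roots decreases the energy for large `α`. -/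
lemma IsEven.eventually_not_isLocalMinimum [NeZero n] (heven : IsEven L)
    (hne : (shell L 2).Nonempty) {H : Matrix (Fin n) (Fin n) ℝ} (hs : H.IsSymm) (h0 : H ≠ 0)
    (htr : H.trace = 0) (hH : ∀ x ∈ shell L 2, quad H x = 0) :
    ∀ᶠ α : ℝ in atTop, IsCritical (gaussian α) L → ¬ IsLocalMinimum (gaussian α) L := by
  obtain ⟨C, hC, hup⟩ := heven.eventually_energy_gram_exp_le hs hH
  obtain ⟨x, hx⟩ := hne
  have hn : (0 : ℝ) < n := Nat.cast_pos.2 (Nat.pos_of_ne_zero (NeZero.ne n))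
  have hκ := trace_mul_self_pos hs h0
  set κ := (H * H).trace
  have hlarge : ∀ᶠ α : ℝ in atTop, C * Real.exp 4 * (α * Real.exp (-α)) < κ / n * 2 := by
    refine Tendsto.eventually_lt_const (v := 0) (mul_pos (div_pos hκ hn) two_pos) ?_
    simpa using tendsto_mul_exp_neg.const_mul (C * Real.exp 4)
  filter_upwards [hlarge, eventually_ge_atTop 2] with α hα hα2 hcrit hmin
  have hα0 : 0 < α := by linarith
  have h2 := le_gaussianMoment_one hα0 hx
  have h3 := (tendsto_exp_smul hs htr).eventually hmin
  -- A local minimum would give this inequality after division by α t². Letting t → 0 removes the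
  -- contribution of the roots and leaves e^{-2α} bounded by a multiple of α e^{-3α}, which `hlarge`
  -- excludes.
  have hev : ∀ᶠ t : ℝ in 𝓝[≠] 0, κ / n * (2 * Real.exp (-2 * α)) ≤
      α * C * (t ^ 2 + Real.exp (4 - 3 * α)) := by
    filter_upwards [nhdsWithin_le_nhds (hup α hα2), nhdsWithin_le_nhds h3,
      nhdsWithin_le_nhds (eventually_le_trace_gram_exp hs h0 htr), self_mem_nhdsWithin]
      with t ht1 ht2 ht3 ht0
    replace ht0 : t ≠ 0 := ht0
    rw [gaussianMoment_of_isCritical L hα0 hcrit (isSymm_transpose_mul_sub_one _)] at ht1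
    set S := (NormedSpace.exp (t • H))ᵀ * NormedSpace.exp (t • H) - 1
    have h4 : energy (gaussian α) (transform 1 L) ≤
      energy (gaussian α) (transform (NormedSpace.exp (t • H)) L) := ht2
    have h5 : κ * t ^ 2 / n * (2 * Real.exp (-2 * α)) ≤ S.trace / n * gaussianMoment L α 1 := by
      have : 0 ≤ S.trace := le_trans (by positivity) ht3
      gcongr
    have h6 := mul_le_mul_of_nonneg_left h5 hα0.le
    have h7 : (α * t ^ 2) * (κ / n * (2 * Real.exp (-2 * α))) ≤
        (α * t ^ 2) * (α * C * (t ^ 2 + Real.exp (4 - 3 * α))) := by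
      calc _ = α * (κ * t ^ 2 / n * (2 * Real.exp (-2 * α))) := by ring
        _ ≤ α ^ 2 * C * t ^ 2 * (t ^ 2 + Real.exp (4 - 3 * α)) := by linarith
        _ = _ := by ring
    exact le_of_mul_le_mul_left h7 (by positivity)
  have hlim : Tendsto (fun t : ℝ ↦ α * C * (t ^ 2 + Real.exp (4 - 3 * α))) (𝓝[≠] 0)
      (𝓝 (α * C * (0 ^ 2 + Real.exp (4 - 3 * α)))) := by
    have hc : Continuous fun t : ℝ ↦ α * C * (t ^ 2 + Real.exp (4 - 3 * α)) := by fun_prop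
    exact (hc.tendsto 0).mono_left nhdsWithin_le_nhds
  have h8 := ge_of_tendsto hlim hev
  have h9 : Real.exp (4 - 3 * α) = Real.exp 4 * Real.exp (-α) * Real.exp (-2 * α) := by
    rw [← Real.exp_add, ← Real.exp_add]; ring_nf
  rw [h9] at h8
  have h10 := mul_lt_mul_of_pos_right hα (Real.exp_pos (-2 * α))
  linarith

end Extrema

/-! ### Eigenvalues of Q and its kernel -/

section Eigenvalues

variable {n : ℕ} {L : Submodule ℤ (EuclideanSpace ℝ (Fin n))}

lemma isEigenvalueQ_zero {H : Matrix (Fin n) (Fin n) ℝ} (hs : H.IsSymm) (h0 : H ≠ 0)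
    (hH : ∀ x ∈ shell L 2, quad H x = 0) : IsEigenvalueQ L 0 := by
  refine ⟨H, hs, h0, fun G _ ↦ ?_⟩
  rw [zero_mul, bQ]
  exact finsum_mem_eq_zero_of_forall_eq_zero fun x hx ↦ by rw [hH x hx, mul_zero]

variable [DiscreteTopology L]

lemma bQ_self (H : Matrix (Fin n) (Fin n) ℝ) :
    bQ L H H = ∑ x ∈ (finite_shell (L := L) 2).toFinset, quad H x ^ 2 := by
  rw [bQ, finsum_mem_eq_finite_toFinset_sum _ (finite_shell (L := L) 2)]
  exact Finset.sum_congr rfl fun x _ ↦ (sq _).symm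

/-- Pairing the eigenvector with itself gives ∑ H[x]² = μ tr(H²) ≤ 0, so every square vanishes. -/
lemma exists_quad_eq_zero_of_isEigenvalueQ {μ : ℝ} (h : IsEigenvalueQ L μ) (hμ : μ ≤ 0) :
    ∃ H : Matrix (Fin n) (Fin n) ℝ, H.IsSymm ∧ H ≠ 0 ∧ ∀ x ∈ shell L 2, quad H x = 0 := by
  obtain ⟨H, hs, h0, hH⟩ := h
  refine ⟨H, hs, h0, fun x hx ↦ ?_⟩
  have h1 := hH H hs
  rw [bQ_self] at h1
  have h2 : ∑ x ∈ (finite_shell (L := L) 2).toFinset, quad H x ^ 2 = 0 :=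
    le_antisymm (h1.trans_le (mul_nonpos_of_nonpos_of_nonneg hμ (trace_mul_self_pos hs h0).le))
      (Finset.sum_nonneg fun _ _ ↦ sq_nonneg _)
  have h3 := (Finset.sum_eq_zero_iff_of_nonneg fun _ _ ↦ sq_nonneg _).1 h2 x (by simpa using hx)
  exact pow_eq_zero_iff two_ne_zero |>.1 h3

/-- An injective linear map on a finite-dimensional space is bounded below. The component H - Hᵀ
makes `T` injective on all matrices, since the values H[x] see only the symmetric part; it is zero
on symmetric S. -/
lemma exists_le_abs_quad (hne : (shell L 2).Nonempty)
    (hinj : ∀ H : Matrix (Fin n) (Fin n) ℝ, H.IsSymm → (∀ x ∈ shell L 2, quad H x = 0) → H = 0) :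
    ∃ κ > 0, ∀ S : Matrix (Fin n) (Fin n) ℝ, S.IsSymm →
      ∃ x ∈ shell L 2, κ * ‖S‖ ≤ |quad S x| := by
  have : Fintype (shell L 2) := (finite_shell (L := L) 2).fintype
  let T : Matrix (Fin n) (Fin n) ℝ →ₗ[ℝ] (shell L 2 → ℝ) × Matrix (Fin n) (Fin n) ℝ :=
    { toFun := fun H ↦ (fun x ↦ quad H x.1, H - Hᵀ)
      map_add' := fun G H ↦ by
        ext i j
        · simp [quad_add]
        · simp; ring
      map_smul' := fun c H ↦ by
        ext i j
        · simp [quad_smul]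
        · simp; ring }
  have hker : LinearMap.ker T = ⊥ := by
    refine (LinearMap.ker_eq_bot').2 fun H hH ↦ ?_
    have h1 : (fun x : shell L 2 ↦ quad H x.1) = 0 := congrArg Prod.fst hH
    have h2 : H - Hᵀ = 0 := congrArg Prod.snd hH
    exact hinj H (sub_eq_zero.1 h2).symm fun x hx ↦ congrFun h1 ⟨x, hx⟩
  obtain ⟨K, hK, hT⟩ := T.exists_antilipschitzWith hker
  have hK' : (0 : ℝ) < K := hK
  refine ⟨(K : ℝ)⁻¹, by positivity, fun S hS ↦ ?_⟩
  have h1 := hT.le_mul_norm (map_zero T) S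
  have h2 : T S = (fun x ↦ quad S x.1, 0) := by
    change (_, S - Sᵀ) = _
    rw [hS.eq, sub_self]
  rw [h2, Prod.norm_mk, norm_zero, max_eq_left (norm_nonneg _)] at h1
  by_contra! hcon
  obtain ⟨y, hy⟩ := hne
  have hpos : 0 < (K : ℝ)⁻¹ * ‖S‖ := (abs_nonneg _).trans_lt (hcon y hy)
  have h3 : ‖fun x : shell L 2 ↦ quad S x.1‖ < (K : ℝ)⁻¹ * ‖S‖ :=
    (pi_norm_lt_iff hpos).2 fun x ↦ hcon x.1 x.2
  have h4 := mul_lt_mul_of_pos_left h3 hK'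
  rw [mul_inv_cancel_left₀ hK'.ne'] at h4
  exact absurd h1 (not_le.2 h4)

/-- A nonzero traceless matrix forces `1 < n`, and then `x xᵀ - (2 / n) I` is a traceless
symmetric matrix which is positive on the root `x`. -/
lemma exists_traceless_quad_pos {H : Matrix (Fin n) (Fin n) ℝ} (h0 : H ≠ 0) (htr : H.trace = 0)
    {x : EuclideanSpace ℝ (Fin n)} (hx : x ∈ shell L 2) :
    ∃ G : Matrix (Fin n) (Fin n) ℝ, G.IsSymm ∧ G.trace = 0 ∧ 0 < quad G x := by
  have hx2 := (mem_shell_two_iff.1 hx).2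
  have hdot : x.ofLp ⬝ᵥ x.ofLp = 2 := by
    rw [← hx2, ← quad_one, quad, Matrix.one_mulVec]
  have hn : 2 ≤ n := by
    rcases n with _ | _ | n
    · exact absurd (Subsingleton.elim H 0) h0
    · refine absurd ?_ h0
      ext i j
      rw [Fin.fin_one_eq_zero i, Fin.fin_one_eq_zero j]
      simpa [Matrix.trace] using htr
    · lia
  have hn' : (2 : ℝ) ≤ n := by exact_mod_cast hn
  refine ⟨Matrix.vecMulVec x.ofLp x.ofLp - (2 / n : ℝ) • 1, ?_, ?_, ?_⟩
  · simp [Matrix.IsSymm, Matrix.transpose_vecMulVec]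
  · rw [Matrix.trace_sub, Matrix.trace_vecMulVec, hdot, Matrix.trace_smul, Matrix.trace_one]
    simp only [Fintype.card_fin, smul_eq_mul]
    field_simp
    ring
  · rw [quad_sub, quad_smul, quad_vecMulVec, hdot, quad_one, hx2]
    have : (2 : ℝ) / n ≤ 1 := (div_le_one (by linarith)).2 hn'
    linarith

end Eigenvalues

end GaussianCore

theorem corollary3p2 (n : ℕ) (hn : n ≤ 32) (L : Submodule ℤ (EuclideanSpace ℝ (Fin n)))
    [DiscreteTopology L] [IsZLattice ℝ L]
    (heven : GaussianCore.IsEven L) (hunimodular : GaussianCore.IsUnimodular L)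
    (hroots : (GaussianCore.shell L 2).Nonempty) :
    ∀ᶠ α : ℝ in atTop, GaussianCore.IsCritical (GaussianCore.gaussian α) L →
      (GaussianCore.IsLocalMinimum (GaussianCore.gaussian α) L ↔
        ∀ μ : ℝ, GaussianCore.IsEigenvalueQ L μ → 0 < μ) ∧
      (GaussianCore.IsEigenvalueQ L 0 →
        GaussianCore.IsSaddlePoint (GaussianCore.gaussian α) L) := by
  open GaussianCore in
  obtain ⟨x, hx⟩ := hroots
  have : NeZero n := ⟨by
    rintro rfl
    exact ne_zero_of_mem_shell hx (Subsingleton.elim _ _)⟩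
  by_cases hker : ∃ H : Matrix (Fin n) (Fin n) ℝ, H.IsSymm ∧ H ≠ 0 ∧
      ∀ x ∈ shell L 2, quad H x = 0
  · obtain ⟨H, hs, h0, hH⟩ := hker
    have hzero : IsEigenvalueQ L 0 := isEigenvalueQ_zero hs h0 hH
    by_cases htr : H.trace = 0
    · obtain ⟨G, hGs, hGtr, hG⟩ := exists_traceless_quad_pos h0 htr hx
      filter_upwards [heven.eventually_not_isLocalMinimum ⟨x, hx⟩ hs h0 htr hH,
        heven.eventually_not_isLocalMaximum hGs hGtr hx hG] with α hmin hmax hcrit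
      exact ⟨iff_of_false (hmin hcrit) fun h ↦ lt_irrefl 0 (h 0 hzero),
        fun _ ↦ ⟨hcrit, hmin hcrit, hmax hcrit⟩⟩
    -- Here L is not critical for any large α, so both claims hold vacuously.
    · filter_upwards [heven.eventually_not_isCritical ⟨x, hx⟩ hs hH htr] with α hα hcrit
      exact absurd hcrit hα
  · have hpos : ∀ μ : ℝ, IsEigenvalueQ L μ → 0 < μ := fun μ hμ ↦ by
      by_contra! h
      exact hker (exists_quad_eq_zero_of_isEigenvalueQ hμ h)
    obtain ⟨κ, hκ, hQ⟩ := exists_le_abs_quad ⟨x, hx⟩ fun H hs hH ↦ by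
      by_contra h0
      exact hker ⟨H, hs, h0, hH⟩
    filter_upwards [heven.eventually_isLocalMinimum hκ hQ] with α hα hcrit
    exact ⟨iff_of_true (hα hcrit) hpos, fun h ↦ absurd (hpos 0 h) (lt_irrefl 0)⟩
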